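/- **Inseparability of coherent radar streams.** *Signals.* Let $f_\mu>0$, $f_s\ge 2f_\mu$, and let $\nu_{\max}\le f_\mu$ with $\nu_{\max}<f_s/2$ (so $\nu_{\max}=f_\mu$ is allowed whenever $f_s>2f_\mu$). For $E,A\in\mathbb R$ let $\mathcal D$ be the class of real signals $$d(t)=\int_{-f_\mu}^{f_\mu} g(f)\,e^{2\pi i f t}\,df+\sum_{\nu\in N} c_\nu e^{2\pi i\nu t},\qquad t\in\mathbb R,$$ where $g\in L^2([-f_\mu,f_\mu])$, $\int_{-f_\mu}^{f_\mu}|g|^2\le E$, $N\subset[-\nu_{\max},\nu_{\max}]$ is finite, $c_\nu\in\mathbb C\setminus\{0\}$ and $\sum_{\nu\in N}|c_\nu|\le A$. *Stream.* A plaintext FMCW range-profile stream with $R$ range bins, $F$ frames, carrier wavelength $\lambda>0$ and slow-time sampling rate $f_s$ is an array of complex samples $z[k,n]$, $1\le k\le R$, $1\le n\le F$, frame $n$ being taken at time $t_n=n/f_s$. Bin $k$ carries a target with radial micro-displacement $d:\mathbb R\to\mathbb R$ if $z[k,n]=a_n e^{i(\varphi_0+4\pi d(t_n)/\lambda)}$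 for all $n$, with some unknown phase $\varphi_0$ and unknown magnitudes $a_n>0$; the other bins are arbitrary. The displacement is small if $|d(t_{n+1})-d(t_n)|<\lambda/4$ for $1\le n<F$. *Protocol.* A protocol assigns to each stream and each value of the random coins the server's view, from which the server computes its output. It grants plaintext access if the samples $z[k,n]$ can be read off the view. *Claim.* For all $\varepsilon,\delta>0$ there is $T_{\min}>0$, depending only on $f_\mu,f_s,\nu_{\max},E,A,\varepsilon,\delta$, such that the following holds for all $R$, $F$ and $\lambda>0$ with $F/f_s\ge T_{\min}$. For every protocol that grants the server plaintext access to the stream, whatever its task, there are functions of the server's view alone, one producing a signal $\hat d_k:\mathbb R\to\mathbb R$ for each bin $k$ and one producing an amplitude $\hat c_k(f)\in\mathbb C$ for each bin $k$ and frequency $f$, such that for every stream, every value of the coins, and every bin $k$ that carries a target with small displacement $d$: 1. $\hat d_k(t_n)=d(t_n)-d(t_1)$ for all $1\le n\le F$; 2. if $d\in\mathcal D$, then $|\hat d_k(t)-(d(t)-d(t_1))|\le\varepsilon$ for all real $t\in[T_{\min}/4,\;F/f_s-T_{\min}/4]$; 3. if $d\in\mathcal D$, then for every frequency $f$ with $\delta\le|f|\le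 f_\mu$ that has distance at least $\delta$ from every $\nu\in N\setminus\{f\}$, $|\hat c_k(f)-c_f|\le\varepsilon$, where $c_f:=0$ if $f\notin N$. In particular, the protocol in which the server receives the stream only in order to compute the energies $|z[k,n]|^2$ for target detection grants plaintext access, and hence has this leakage. -/

import Mathlib

open MeasureTheory

noncomputable section

namespace Radar

/-- A plaintext FMCW range-profile stream with `R` range bins and `F` frames: the complex sample
`z k n` of range bin `k` in frame `n`. -/
abbrev Stream (R F : ℕ) : Type := Fin R → Fin F → ℂ

/-- Slow-time instant of the frame with index `n`; the frames `n = 0, …, F - 1` are taken at the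
times `1 / fs, 2 / fs, …, F / fs`. -/
def frameTime (fs : ℝ) (n : ℕ) : ℝ := ((n : ℝ) + 1) / fs

/-- Range bin `k` of the stream `z` carries a target with radial micro-displacement `d`
(in the same unit of length as the carrier wavelength `lam`): a displacement `d` shifts the phase of
the samples by `4 π d / lam`.  The static phase `φ₀` and the positive, possibly time-varying
magnitudes `a n` are arbitrary; nothing is required of the other bins. -/
def TargetAt {R F : ℕ} (lam fs : ℝ) (z : Stream R F) (k : Fin R) (d : ℝ → ℝ) : Prop :=
  ∃ (φ₀ : ℝ) (a : Fin F → ℝ), (∀ n, 0 < a n) ∧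
    ∀ n, z k n =
      (a n : ℂ) * Complex.exp (((φ₀ + 4 * Real.pi * d (frameTime fs n) / lam : ℝ) : ℂ) * Complex.I)

/-- The displacement is small: from each frame to the next it changes by less than a quarter of the
wavelength (a phase shift of less than `π`).  This holds in particular if `|d| < lam / 8`. -/
def SmallSteps (F : ℕ) (lam fs : ℝ) (d : ℝ → ℝ) : Prop :=
  ∀ n : ℕ, n + 1 < F → |d (frameTime fs (n + 1)) - d (frameTime fs n)| < lam / 4

/-- Spectrum of a motion: a spectral density and finitely many spectral lines;
`line ν` is the complex amplitude of the component `exp (2 π i ν t)`. -/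
structure Spectrum where
  density : ℝ → ℂ
  line : ℝ →₀ ℂ

/-- The elementary oscillation `exp (2 π i f t)`. -/
def osc (f t : ℝ) : ℂ := Complex.exp (((2 * Real.pi * f * t : ℝ) : ℂ) * Complex.I)

/-- The signal with spectrum `S`, the density being restricted to the band `[-fμ, fμ]`. -/
def Spectrum.signal (S : Spectrum) (fμ t : ℝ) : ℂ :=
  (∫ f in Set.Icc (-fμ) fμ, S.density f * osc f t) + ∑ ν ∈ S.line.support, S.line ν * osc ν t

/-- `d` is the real signal with spectrum `S`.  It is band-limited to `[-fμ, fμ]`; its continuous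
part is square-integrable with energy at most `E`; its spectral lines lie in `[-νmax, νmax]`, and
their amplitudes add up to at most `A`. -/
structure HasSpectrum (fμ νmax E A : ℝ) (d : ℝ → ℝ) (S : Spectrum) : Prop where
  memLp : MemLp S.density 2 (volume.restrict (Set.Icc (-fμ) fμ))
  energy_le : ∫ f in Set.Icc (-fμ) fμ, ‖S.density f‖ ^ 2 ≤ E
  abs_line_le : ∀ ν ∈ S.line.support, |ν| ≤ νmax
  amplitude_le : ∑ ν ∈ S.line.support, ‖S.line ν‖ ≤ A
  eq_signal : ∀ t : ℝ, (d t : ℂ) = S.signal fμ t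

/-- A protocol between a client, who holds a stream, and a server: `view z ω` is everything the
server sees in the execution on the stream `z` with random coins `ω` (a semi-honest server follows
the protocol and keeps its view), and `output` is the result that it computes for its task. -/
structure Protocol (R F : ℕ) (Coins View Out : Type*) where
  view : Stream R F → Coins → View
  output : View → Out

/-- The server has plaintext access to the stream: the samples can be read off its view. -/
def Protocol.GrantsPlaintextAccess {R F : ℕ} {Coins View Out : Type*}
    (P : Protocol R F Coins View Out) : Prop :=
  ∃ read : View → Stream R F, ∀ z ω, read (P.view z ω) = z

/-- The protocol in which the server gets the stream for energy-based target detection and for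
nothing else: its output is the table of energies `|z k n| ^ 2`. -/
def energyDetection (R F : ℕ) : Protocol R F Unit (Stream R F) (Fin R → Fin F → ℝ) where
  view z _ := z
  output z k n := ‖z k n‖ ^ 2

/-- What the server's view leaks.  There are fixed functions of the view, `recon` (a displacement
signal for each bin) and `spec` (a complex amplitude for each bin and frequency), such that for
every stream, every execution and every bin that carries a target with small displacement `d`:
* `recon` equals the displacement from the position in the first frame at every sampling instant;
* if `d` has a spectrum `S` as in `HasSpectrum`, then `recon` is `ε`-close to this displacement at
  all times of the observation interval `[0, F / fs]` that are at least `m` away from its ends;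
* in that case also, `spec` gives the amplitude of `d` at `f` up to `ε`, for each frequency `f`
  up to `fμ` that is at least `δ` away from `0` and from all other spectral lines of `d`. -/
def Protocol.LeaksMicroDisplacement {R F : ℕ} {Coins View Out : Type*}
    (P : Protocol R F Coins View Out) (lam fs fμ νmax E A ε δ m : ℝ) : Prop :=
  ∃ (recon : View → Fin R → ℝ → ℝ) (spec : View → Fin R → ℝ → ℂ),
    ∀ (z : Stream R F) (ω : Coins) (k : Fin R) (d : ℝ → ℝ),
      TargetAt lam fs z k d → SmallSteps F lam fs d →
        (∀ n : ℕ, n < F →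
          recon (P.view z ω) k (frameTime fs n) = d (frameTime fs n) - d (frameTime fs 0)) ∧
        ∀ S : Spectrum, HasSpectrum fμ νmax E A d S →
          (∀ t ∈ Set.Icc m ((F : ℝ) / fs - m),
            |recon (P.view z ω) k t - (d t - d (frameTime fs 0))| ≤ ε) ∧
          (∀ f : ℝ, |f| ≤ fμ → δ ≤ |f| → (∀ ν ∈ S.line.support, ν ≠ f → δ ≤ |f - ν|) →
            ‖spec (P.view z ω) k f - S.line f‖ ≤ ε)

end Radar

end

open MeasureTheory

noncomputable section

namespace Radar

/-! The stream determines the displacement at the frame times: a step below a quarter wavelength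
changes the phase by less than `π`, so the argument of the quotient of consecutive samples is the
exact phase increment, and the increments telescope (`unwrap_samples`). The rest is sampling theory
for `d - d(t₁)`: the server forms the truncated cardinal series and the normalised discrete Fourier
transform of the unwrapped samples.

Both are linear in `d`, so their errors are integrals of explicit kernels against the spectrum. By
Cauchy-Schwarz the density only needs a kernel that is small in `L²` of the band; the lines need it
small at each of their frequencies.

For interpolation the kernel is `samplingError`. In the frequency variable, the cardinal series is
the Fourier series of `ξ ↦ exp (2πiξt)` on `[-fs/2, fs/2]`, so Parseval gives the `L²` bound, even
for `fs = 2 fμ`. The periodic extension may jump at `±fs/2`; multiplication by `1 + exp (2πiξ/fs)`,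
which vanishes there, makes the series absolutely convergent and gives a uniform bound away from the
Nyquist frequency (`exists_norm_samplingError_le`). This is where `νmax < fs/2` enters.

For amplitudes the kernel is `dftMean`: it is `1` at `f`, `O(1/F)` at frequencies separated from `f`
modulo `fs` (a geometric sum), and has squared `L²` norm at most `fs/F`.

Subtracting `d(t₁)` alters the line at frequency `0`; hence the terms with kernel value at `0`, and
the condition `δ ≤ |f|`. -/

/-! ### Elementary oscillations -/

lemma osc_comm (f t : ℝ) : osc f t = osc t f := by
  unfold osc; rw [mul_right_comm]

lemma osc_add_right (f s t : ℝ) : osc f (s + t) = osc f s * osc f t := by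
  unfold osc; rw [← Complex.exp_add]; congr 1; push_cast; ring

lemma osc_add_left (f g t : ℝ) : osc (f + g) t = osc f t * osc g t := by
  rw [osc_comm, osc_add_right, osc_comm t f, osc_comm t g]

@[simp] lemma osc_zero_left (t : ℝ) : osc 0 t = 1 := by simp [osc]

lemma osc_neg_right (f t : ℝ) : osc f (-t) = osc (-f) t := by
  unfold osc; rw [mul_neg, mul_neg, neg_mul]

@[simp] lemma norm_osc (f t : ℝ) : ‖osc f t‖ = 1 := by
  unfold osc; exact Complex.norm_exp_ofReal_mul_I _

lemma osc_mul_nat (f t : ℝ) (n : ℕ) : osc f (n * t) = osc f t ^ n := by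
  unfold osc; rw [← Complex.exp_nat_mul]; congr 1; push_cast; ring

@[fun_prop] lemma continuous_osc_left (t : ℝ) : Continuous fun f ↦ osc f t := by
  unfold osc; fun_prop

/-! ### Cardinal sines as Fourier coefficients in the frequency variable -/

/-- The cardinal sine centred at the `n`-th sampling instant `n / fs`. -/
def cardinal (fs t : ℝ) (n : ℤ) : ℝ := Real.sinc (Real.pi * (fs * t - n))

lemma sinc_pi_mul_int (m : ℤ) : Real.sinc (Real.pi * m) = if m = 0 then 1 else 0 := by
  split_ifs with h
  · simp [h]
  · rw [Real.sinc_of_ne_zero (by simp [Real.pi_ne_zero, h]), mul_comm, Real.sin_int_mul_pi]; simp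

lemma cardinal_frameTime {fs : ℝ} (hfs : 0 < fs) (i : ℕ) (n : ℤ) :
    cardinal fs (frameTime fs i) n = if n = i + 1 then 1 else 0 := by
  unfold cardinal frameTime
  have : fs * ((i + 1 : ℝ) / fs) - n = ((i + 1 - n : ℤ) : ℝ) := by
    push_cast; field_simp
  rw [this, sinc_pi_mul_int]
  congr 1
  simp only [eq_iff_iff]; omega

lemma abs_sinc_pi_mul_le {y : ℝ} (hy : y ≠ 0) : |Real.sinc (Real.pi * y)| ≤ 1 / |y| := by
  have hpi := Real.pi_gt_three
  rw [Real.sinc_of_ne_zero (by positivity), abs_div, abs_mul, abs_of_pos Real.pi_pos]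
  have := Real.abs_sin_le_one (Real.pi * y)
  have hy' : 0 < |y| := abs_pos.2 hy
  rw [div_le_div_iff₀ (by positivity) hy']
  nlinarith

lemma fourierCoeffOn_band {fs : ℝ} (hfs : 0 < fs) (f : ℝ → ℂ) (n : ℤ) :
    fourierCoeffOn (show -(fs / 2) < fs / 2 by linarith) f n =
      (1 / fs) • ∫ ξ in -(fs / 2)..(fs / 2), osc ξ (-(n / fs)) * f ξ := by
  rw [fourierCoeffOn_eq_integral]
  have : fs / 2 - -(fs / 2) = fs := by ring
  congr 1
  · rw [this]
  · refine intervalIntegral.integral_congr fun ξ _ ↦ ?_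
    simp only [smul_eq_mul]
    congr 1
    rw [fourier_coe_apply, this, osc]
    congr 1
    push_cast
    have : (fs : ℂ) ≠ 0 := by exact_mod_cast hfs.ne'
    field_simp

lemma integral_osc_band {fs : ℝ} (hfs : 0 < fs) (s : ℝ) :
    ∫ ξ in -(fs / 2)..(fs / 2), osc ξ s = fs * (Real.sinc (Real.pi * (fs * s)) : ℝ) := by
  rcases eq_or_ne s 0 with rfl | hs
  · simp [osc]
  · have hpi := Real.pi_ne_zero
    have hc : (2 * Real.pi * s * Complex.I : ℂ) ≠ 0 := by simp [hs, hpi]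
    have h := integral_exp_mul_complex (a := -(fs / 2)) (b := fs / 2) hc
    have e : ∀ ξ : ℝ, osc ξ s = Complex.exp (2 * Real.pi * s * Complex.I * ξ) := fun ξ ↦ by
      unfold osc; congr 1; push_cast; ring
    simp_rw [e]
    rw [h, Real.sinc_of_ne_zero (by positivity)]
    have hs' : (s : ℂ) ≠ 0 := by exact_mod_cast hs
    have hf' : (fs : ℂ) ≠ 0 := by exact_mod_cast hfs.ne'
    have hp' : (Real.pi : ℂ) ≠ 0 := by exact_mod_cast hpi
    have h2 := Complex.two_sin (Real.pi * (fs * s) : ℂ)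
    push_cast
    rw [show (2 * Real.pi * s * Complex.I * (fs / 2) : ℂ) = Real.pi * (fs * s) * Complex.I by ring,
      show (2 * Real.pi * s * Complex.I * -(fs / 2) : ℂ) = -(Real.pi * (fs * s)) * Complex.I by ring]
    have h3 : Complex.exp (Real.pi * (fs * s) * Complex.I)
        - Complex.exp (-(Real.pi * (fs * s)) * Complex.I)
        = 2 * Complex.sin (Real.pi * (fs * s)) * Complex.I := by
      rw [h2]; linear_combination (Complex.exp (-(Real.pi * (fs * s)) * Complex.I) -
        Complex.exp (Real.pi * (fs * s) * Complex.I)) * -Complex.I_mul_I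
    rw [h3]
    field_simp

/-- This identifies the cardinal series with a Fourier series in `ξ`, `t` being a parameter; all
error bounds for interpolation rest on it. -/
lemma fourierCoeffOn_osc {fs : ℝ} (hfs : 0 < fs) (t : ℝ) (n : ℤ) :
    fourierCoeffOn (show -(fs / 2) < fs / 2 by linarith) (fun ξ ↦ osc ξ t) n
      = cardinal fs t n := by
  rw [fourierCoeffOn_band hfs]
  simp_rw [← osc_add_right]
  rw [integral_osc_band hfs, cardinal, Complex.real_smul]
  have hf' : (fs : ℂ) ≠ 0 := by exact_mod_cast hfs.ne'
  have : fs * (-(n / fs) + t) = fs * t - n := by field_simp; ring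
  rw [this]; push_cast; field_simp

/-! ### Truncated cardinal series: mean-square error -/

/-- The inverse squares of the distances of a point to the integers have uniformly small tails. -/
lemma exists_tail_bound {η : ℝ} (hη : 0 < η) : ∃ L : ℝ, 2 ≤ L ∧ ∀ (x : ℝ) (s : Finset ℤ),
    (∀ n ∈ s, L ≤ |x - n|) → ∑ n ∈ s, 1 / (x - n) ^ 2 ≤ η := by
  obtain ⟨K, hK⟩ := summable_iff_vanishing_norm.1
    (Real.summable_one_div_int_pow.2 (one_lt_two)) (η / 4) (by positivity)
  obtain ⟨M, hM⟩ : ∃ M : ℝ, ∀ k ∈ K, |(k : ℝ)| ≤ M :=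
    ⟨∑ k ∈ K, |(k : ℝ)|, fun k hk ↦ Finset.single_le_sum (f := fun k : ℤ ↦ |(k : ℝ)|)
      (fun _ _ ↦ abs_nonneg _) hk⟩
  -- Rounding `x` to `⌊x⌋` changes distances by at most `1`. Distance at least `2` makes this a
  -- factor of at most `2`, whence the `4` after squaring; distance at least `M + 2` keeps the
  -- shifted indices out of `K`.
  refine ⟨max 2 (M + 2), le_max_left _ _, fun x s hs ↦ ?_⟩
  have hfl := Int.floor_le x
  have hfl' := Int.lt_floor_add_one x
  have key : ∀ n ∈ s, M < |((n - ⌊x⌋ : ℤ) : ℝ)| ∧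
      1 / (x - n) ^ 2 ≤ 4 * (1 / ((n - ⌊x⌋ : ℤ) : ℝ) ^ 2) := fun n hn ↦ by
    have h := hs n hn
    have h2 : 2 ≤ |x - n| := (le_max_left _ _).trans h
    have h3 : M + 2 ≤ |x - n| := (le_max_right _ _).trans h
    push_cast
    have h4 : |x - n| ≤ |(n : ℝ) - ⌊x⌋| + 1 := by
      rw [abs_le]; constructor <;>
      rcases abs_cases ((n : ℝ) - ⌊x⌋) with h | h <;> linarith
    have h5 : |(n : ℝ) - ⌊x⌋| ≤ |x - n| + 1 := by
      rw [abs_le]; constructor <;>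
      rcases abs_cases (x - n) with h | h <;> linarith
    refine ⟨by linarith, ?_⟩
    rw [mul_one_div, ← sq_abs (x - n), ← sq_abs ((n : ℝ) - ⌊x⌋), div_le_div_iff₀ (by positivity)
      (by have : 0 < |(n : ℝ) - ⌊x⌋| := by linarith
          positivity)]
    nlinarith [abs_nonneg ((n : ℝ) - ⌊x⌋)]
  have hinj : Set.InjOn (fun n : ℤ ↦ n - ⌊x⌋) s := fun a _ b _ h ↦ by simpa using h
  have hd : Disjoint (s.image fun n ↦ n - ⌊x⌋) K := by
    rw [Finset.disjoint_left]
    rintro k hk hk'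
    obtain ⟨n, hn, rfl⟩ := Finset.mem_image.1 hk
    exact absurd (hM _ hk') (not_le.2 (key n hn).1)
  have := (le_abs_self _).trans (hK _ hd).le
  rw [Finset.sum_image hinj] at this
  calc ∑ n ∈ s, 1 / (x - n) ^ 2 ≤ ∑ n ∈ s, 4 * (1 / ((n - ⌊x⌋ : ℤ) : ℝ) ^ 2) :=
        Finset.sum_le_sum fun n hn ↦ (key n hn).2
    _ ≤ η := by rw [← Finset.mul_sum]; linarith

/-- The error of the truncated cardinal series for the oscillation of frequency `ξ` at time `t`. -/
def samplingError (fs : ℝ) (F : ℕ) (t ξ : ℝ) : ℂ :=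
  osc ξ t - ∑ i ∈ Finset.range F, (cardinal fs t (i + 1) : ℂ) * osc ξ (frameTime fs i)

@[fun_prop] lemma continuous_samplingError (fs : ℝ) (F : ℕ) (t : ℝ) :
    Continuous (samplingError fs F t) := by
  unfold samplingError; fun_prop

/-- Orthogonality of the exponentials at the frame times: a cardinal sine is a Kronecker delta
there. Frame `i` carries Fourier mode `i + 1`, since the first frame is taken at `1 / fs`. -/
lemma fourierCoeffOn_sum_osc {fs : ℝ} (hfs : 0 < fs) (F : ℕ) (c : ℕ → ℂ) (n : ℤ) :
    fourierCoeffOn (show -(fs / 2) < fs / 2 by linarith)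
      (fun ξ ↦ ∑ i ∈ Finset.range F, c i * osc ξ (frameTime fs i)) n
      = ∑ i ∈ Finset.range F, c i * (if n = i + 1 then 1 else 0) := by
  rw [fourierCoeffOn_band hfs]
  simp_rw [Finset.mul_sum]
  rw [intervalIntegral.integral_finsetSum
    fun i _ ↦ Continuous.intervalIntegrable (by fun_prop) _ _, Finset.smul_sum]
  refine Finset.sum_congr rfl fun i _ ↦ ?_
  have h := fourierCoeffOn_osc hfs (frameTime fs i) n
  rw [cardinal_frameTime hfs, fourierCoeffOn_band hfs] at h
  rw [show (if n = (i : ℤ) + 1 then (1 : ℂ) else 0) = ((if n = (i : ℤ) + 1 then 1 else 0 : ℝ) : ℂ) by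
    split_ifs <;> simp, ← h, mul_smul_comm, ← intervalIntegral.integral_const_mul]
  congr 2
  ext ξ; ring

lemma fourierCoeffOn_samplingError {fs : ℝ} (hfs : 0 < fs) (F : ℕ) (t : ℝ) (n : ℤ) :
    fourierCoeffOn (show -(fs / 2) < fs / 2 by linarith) (samplingError fs F t) n
      = if 1 ≤ n ∧ n ≤ F then 0 else (cardinal fs t n : ℂ) := by
  have h : fourierCoeffOn (show -(fs / 2) < fs / 2 by linarith) (samplingError fs F t) n
      = cardinal fs t n - ∑ i ∈ Finset.range F, (cardinal fs t (i + 1) : ℂ) *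
        (if n = i + 1 then 1 else 0) := by
    rw [← fourierCoeffOn_osc hfs, ← fourierCoeffOn_sum_osc hfs, fourierCoeffOn_band hfs,
      fourierCoeffOn_band hfs, fourierCoeffOn_band hfs, ← smul_sub,
      ← intervalIntegral.integral_sub (Continuous.intervalIntegrable (by fun_prop) _ _)
        (Continuous.intervalIntegrable (by fun_prop) _ _)]
    simp_rw [samplingError, mul_sub]
  rw [h]
  split_ifs with hn
  · rw [Finset.sum_eq_single (n - 1).toNat]
    · have : (((n - 1).toNat : ℕ) : ℤ) + 1 = n := by omega
      rw [this, if_pos rfl]; simp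
    · intro i _ hi
      rw [if_neg (by omega)]; simp
    · intro hi
      simp at hi; omega
  · rw [Finset.sum_eq_zero, sub_zero]
    intro i hi
    have := Finset.mem_range.1 hi
    rw [if_neg (by omega)]; simp

/-- Indices outside the observation window are far from interior points. -/
lemma le_abs_sub_of_not_mem_window {x L : ℝ} {F : ℕ} (hx : L ≤ x) (hx' : x ≤ F - L) {n : ℤ}
    (hn : ¬ (1 ≤ n ∧ n ≤ F)) : L ≤ |x - n| := by
  by_cases h : 1 ≤ n
  · have : (F : ℤ) + 1 ≤ n := by omega
    have : (F : ℝ) + 1 ≤ n := by exact_mod_cast this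
    rw [abs_sub_comm]
    exact le_trans (by linarith) (le_abs_self _)
  · have : n ≤ 0 := by omega
    have : (n : ℝ) ≤ 0 := by exact_mod_cast this
    exact le_trans (by linarith) (le_abs_self _)

lemma memLp_Icc_of_continuous {f : ℝ → ℂ} (hf : Continuous f) (p : ENNReal) (a b : ℝ) :
    MemLp f p (volume.restrict (Set.Icc a b)) := by
  obtain ⟨C, hC⟩ := isCompact_Icc.exists_bound_of_continuousOn (s := Set.Icc a b) hf.continuousOn
  exact MemLp.of_bound hf.aestronglyMeasurable C
    ((ae_restrict_iff' measurableSet_Icc).2 (.of_forall hC))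

/-- By Parseval the mean-square error is the sum of `cardinal ^ 2` over the indices outside the
window. These are far from `fs * t`, so their inverse-square tail is small. -/
lemma exists_integral_sq_samplingError_le {fs η : ℝ} (hfs : 0 < fs) (hη : 0 < η) :
    ∃ L : ℝ, 2 ≤ L ∧ ∀ (F : ℕ) (t : ℝ), L ≤ fs * t → fs * t ≤ F - L →
      ∫ ξ in -(fs / 2)..(fs / 2), ‖samplingError fs F t ξ‖ ^ 2 ≤ η := by
  obtain ⟨L, hL, h⟩ := exists_tail_bound (η := η / fs) (by positivity)
  refine ⟨L, hL, fun F t ht ht' ↦ ?_⟩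
  have hab : -(fs / 2) < fs / 2 := by linarith
  have hs := hasSum_sq_fourierCoeffOn hab (f := samplingError fs F t)
    ((memLp_Icc_of_continuous (continuous_samplingError fs F t) _ _ _).mono_measure
      (Measure.restrict_mono Set.Ioc_subset_Icc_self le_rfl))
  have := hasSum_le_of_sum_le hs (c := η / fs) fun s ↦ ?_
  · rw [show fs / 2 - -(fs / 2) = fs by ring, smul_eq_mul, inv_mul_le_iff₀ hfs] at this
    rwa [mul_div_cancel₀ _ hfs.ne'] at this
  · simp_rw [fourierCoeffOn_samplingError hfs]
    rw [← Finset.sum_filter_add_sum_filter_not s (fun n : ℤ ↦ 1 ≤ n ∧ n ≤ F)]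
    rw [Finset.sum_eq_zero (fun n hn ↦ by rw [if_pos (Finset.mem_filter.1 hn).2]; simp), zero_add]
    refine le_trans (Finset.sum_le_sum fun n hn ↦ ?_) (h (fs * t) (s.filter fun n : ℤ ↦
      ¬ (1 ≤ n ∧ n ≤ F)) fun n hn ↦ le_abs_sub_of_not_mem_window ht ht' (Finset.mem_filter.1 hn).2)
    have hn' := (Finset.mem_filter.1 hn).2
    have hd := le_abs_sub_of_not_mem_window ht ht' hn'
    have h0 : fs * t - n ≠ 0 := fun h ↦ by rw [h, abs_zero] at hd; linarith
    rw [if_neg hn', Complex.norm_real, Real.norm_eq_abs, cardinal, ← sq_abs (fs * t - n),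
      ← one_div_pow]
    exact pow_le_pow_left₀ (abs_nonneg _) (abs_sinc_pi_mul_le h0) 2

/-! ### Truncated cardinal series: uniform error below the Nyquist frequency -/

lemma abs_cardinal_le {fs t : ℝ} {n : ℤ} {L : ℝ} (hL : 0 < L) (h : L ≤ |fs * t - n|) :
    |cardinal fs t n| ≤ 1 / L := by
  have h0 : fs * t - n ≠ 0 := abs_pos.1 (hL.trans_le h)
  exact (abs_sinc_pi_mul_le h0).trans (one_div_le_one_div_of_le hL h)

/-- Neighbouring values of the cardinal series alternate in sign, so their sums decay quadratically. -/
lemma abs_cardinal_add_cardinal_le {fs t : ℝ} {n : ℤ} (h : 2 ≤ |fs * t - n|) :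
    |cardinal fs t n + cardinal fs t (n - 1)| ≤ 1 / (fs * t - n) ^ 2 := by
  unfold cardinal
  set y := fs * t - n with hy
  have hpi := Real.pi_gt_three
  have e : fs * t - ((n - 1 : ℤ) : ℝ) = y + 1 := by push_cast; rw [hy]; ring
  have h1 : |y| / 2 ≤ |y + 1| := by
    rcases abs_cases y with h | h <;> rcases abs_cases (y + 1) with h' | h' <;> linarith
  have hy0 : y ≠ 0 := abs_pos.1 (by linarith)
  have hy1 : y + 1 ≠ 0 := abs_pos.1 (by linarith)
  rw [e, Real.sinc_of_ne_zero (by positivity), Real.sinc_of_ne_zero (by positivity),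
    mul_add, mul_one, Real.sin_add_pi]
  have e2 : Real.sin (Real.pi * y) / (Real.pi * y) + -Real.sin (Real.pi * y) / (Real.pi * y + Real.pi)
      = Real.sin (Real.pi * y) / (Real.pi * (y * (y + 1))) := by
    have : Real.pi * y + Real.pi ≠ 0 := by
      rw [← mul_add_one]; positivity
    field_simp
    ring
  rw [e2, abs_div, abs_mul, abs_mul, abs_of_pos Real.pi_pos, ← sq_abs y,
    div_le_div_iff₀ (by positivity) (by positivity)]
  have := Real.abs_sin_le_one (Real.pi * y)
  have h2 : |y| * |y| ≤ 2 * (|y| * |y + 1|) := by nlinarith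
  have h3 : 0 ≤ |y| * |y + 1| := by positivity
  nlinarith [mul_self_nonneg |y|]

/-- Pointwise convergence of the regularised cardinal series. -/
lemma hasSum_regularized {fs : ℝ} (hfs : 0 < fs) (t : ℝ) {ξ : ℝ} (hξ : |ξ| < fs / 2) :
    HasSum (fun n : ℤ ↦ ((cardinal fs t n + cardinal fs t (n - 1) : ℝ) : ℂ) * osc ξ (n / fs))
      ((1 + osc ξ (1 / fs)) * osc ξ t) := by
  have : Fact (0 < fs) := ⟨hfs⟩
  have hf' : (fs : ℂ) ≠ 0 := by exact_mod_cast hfs.ne'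
  set h : ℝ → ℂ := fun ξ ↦ (1 + osc ξ (1 / fs)) * osc ξ t with hh
  have hcont : Continuous h := by fun_prop
  -- The factor `1 + osc ξ (1 / fs)` vanishes at both ends of the band, so `h` has a continuous
  -- periodic extension.
  have hper : h (-(fs / 2)) = h (-(fs / 2) + fs) := by
    have e1 : osc (-(fs / 2)) (1 / fs) = -1 := by
      rw [osc, ← Complex.exp_pi_mul_I, ← Complex.exp_periodic.sub_eq (Real.pi * Complex.I)]
      congr 1; push_cast; field_simp; ring
    have e2 : osc (-(fs / 2) + fs) (1 / fs) = -1 := by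
      rw [osc, ← Complex.exp_pi_mul_I]
      congr 1; push_cast; field_simp; ring
    simp only [hh, e1, e2, add_neg_cancel, zero_mul]
  set H : C(AddCircle fs, ℂ) :=
    ⟨AddCircle.liftIco fs (-(fs / 2)) h, AddCircle.liftIco_continuous hper hcont.continuousOn⟩
  have hcoef : ∀ n : ℤ, fourierCoeff H n =
      ((cardinal fs t n + cardinal fs t (n - 1) : ℝ) : ℂ) := fun n ↦ by
    have : fourierCoeff H n = fourierCoeffOn (show -(fs / 2) < fs / 2 by linarith) h n := by
      change fourierCoeff (AddCircle.liftIco fs (-(fs / 2)) h) n = _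
      rw [fourierCoeff_liftIco_eq]
      congr 1
      ring
    -- Multiplication by `osc ξ (1 / fs)` shifts time by one sampling step, that is, shifts the
    -- coefficients by one index.
    have hshift : cardinal fs t (n - 1) = cardinal fs (t + 1 / fs) n := by
      unfold cardinal; congr 2; push_cast; field_simp; ring
    rw [this, hshift]
    push_cast
    rw [← fourierCoeffOn_osc hfs, ← fourierCoeffOn_osc hfs, fourierCoeffOn_band hfs,
      fourierCoeffOn_band hfs, fourierCoeffOn_band hfs, ← smul_add,
      ← intervalIntegral.integral_add]
    · congr 2
      ext ξ
      rw [hh, osc_add_right]; ring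
    · exact (Continuous.intervalIntegrable (by fun_prop) _ _)
    · exact (Continuous.intervalIntegrable (by fun_prop) _ _)
  have hsum : Summable (fourierCoeff H) := by
    have hs : Summable fun n : ℤ ↦ 1 / (fs * t - n) ^ 2 := by
      have := (Real.summable_one_div_int_add_rpow (-(fs * t)) 2).2 one_lt_two
      refine this.congr fun n ↦ ?_
      rw [Real.rpow_two, sq_abs]; congr 1; ring
    -- The quadratic bound needs distance at least `2` from `fs * t`, which only finitely many
    -- indices violate.
    refine hs.of_norm_bounded_eventually ?_
    obtain ⟨N, hN⟩ := exists_nat_gt (|fs * t| + 2)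
    refine (Finset.finite_toSet (Finset.Icc (-N : ℤ) N)).subset fun n hn ↦ ?_
    by_contra hc
    refine hn ?_
    rw [Set.mem_ofPred_eq, hcoef, Complex.norm_real]
    refine abs_cardinal_add_cardinal_le ?_
    have hN' : (N : ℝ) ≤ |(n : ℝ)| := by
      have : (N : ℤ) ≤ |n| := by
        simp only [Finset.coe_Icc, Set.mem_Icc, not_and_or, not_le] at hc
        rcases abs_cases n with h | h <;> omega
      exact_mod_cast this
    have := abs_sub_abs_le_abs_sub (n : ℝ) (fs * t)
    rw [abs_sub_comm]; linarith
  have hξ' := abs_lt.1 hξ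
  have := has_pointwise_sum_fourier_series_of_summable hsum (ξ : AddCircle fs)
  have hv : H (ξ : AddCircle fs) = h ξ :=
    AddCircle.liftIco_coe_apply (f := h) (p := fs) (a := -(fs / 2)) ⟨hξ'.1.le, by linarith⟩
  rw [hv] at this
  convert! this using 2 with n
  rw [hcoef, smul_eq_mul, fourier_coe_apply, osc]
  congr 2
  push_cast; ring

lemma norm_sub_sum_le_of_hasSum {ι : Type*} {g : ι → ℂ} {a : ℂ} (hg : HasSum g a) (W : Finset ι)
    {η : ℝ} (h : ∀ s : Finset ι, Disjoint s W → ‖∑ n ∈ s, g n‖ ≤ η) :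
    ‖a - ∑ n ∈ W, g n‖ ≤ η := by
  classical
  have ht := (Filter.Tendsto.sub_const hg (∑ n ∈ W, g n)).norm
  refine le_of_tendsto ht ((Filter.eventually_ge_atTop W).mono fun s hs ↦ ?_)
  rw [← Finset.sum_sdiff hs, add_sub_cancel_right]
  exact h _ Finset.sdiff_disjoint

/-- Taking real parts suffices. The bound is positive for `β` below the Nyquist frequency, so the
regularising factor can be divided out. -/
lemma one_add_cos_le_norm_one_add_osc {fs β ξ : ℝ} (hfs : 0 < fs) (hβ : 2 * β < fs)
    (hξ : |ξ| ≤ β) : 1 + Real.cos (2 * Real.pi * β / fs) ≤ ‖1 + osc ξ (1 / fs)‖ := by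
  refine le_trans ?_ (Complex.re_le_norm _)
  rw [Complex.add_re, Complex.one_re, osc, Complex.exp_ofReal_mul_I_re]
  have hpi := Real.pi_pos
  rw [← Real.cos_abs (2 * Real.pi * ξ * (1 / fs))]
  have : |2 * Real.pi * ξ * (1 / fs)| = 2 * Real.pi * |ξ| / fs := by
    rw [abs_mul, abs_mul, abs_of_pos (show 0 < 2 * Real.pi by positivity),
      abs_of_pos (one_div_pos.2 hfs), mul_one_div]
  rw [this]
  gcongr
  refine Real.cos_le_cos_of_nonneg_of_le_pi (by positivity) ?_ (by gcongr)
  rw [div_le_iff₀ hfs]; nlinarith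

lemma one_add_cos_pos {fs β : ℝ} (hfs : 0 < fs) (hβ0 : 0 ≤ β) (hβ : 2 * β < fs) :
    0 < 1 + Real.cos (2 * Real.pi * β / fs) := by
  have hpi := Real.pi_pos
  have := Real.cos_lt_cos_of_nonneg_of_le_pi (x := 2 * Real.pi * β / fs) (y := Real.pi)
    (by positivity) le_rfl (by rw [div_lt_iff₀ hfs]; nlinarith)
  rw [Real.cos_pi] at this
  linarith

/-- Summation by parts: the two shifted copies of the truncated series overlap in the indices `2, …,
N + 1`, leaving boundary terms at `1` and `N + 2`. -/
lemma one_add_osc_mul_samplingError {fs : ℝ} (N : ℕ) (t ξ : ℝ) :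
    (1 + osc ξ (1 / fs)) * samplingError fs (N + 1) t ξ =
      ((1 + osc ξ (1 / fs)) * osc ξ t - ∑ n ∈ (Finset.range N).image fun i : ℕ ↦ (i : ℤ) + 2,
        ((cardinal fs t n + cardinal fs t (n - 1) : ℝ) : ℂ) * osc ξ (n / fs))
      - cardinal fs t 1 * osc ξ (1 / fs)
      - cardinal fs t (N + 1) * osc ξ ((N + 2) / fs) := by
  have hinj : Set.InjOn (fun i : ℕ ↦ (i : ℤ) + 2) (Finset.range N) := fun a _ b _ h ↦ by
    simpa using h
  have e : ∀ i : ℕ, osc ξ (1 / fs) * ((cardinal fs t (i + 1) : ℂ) * osc ξ (frameTime fs i)) =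
      (cardinal fs t (i + 1) : ℂ) * osc ξ ((i + 2) / fs) := fun i ↦ by
    rw [mul_left_comm, ← osc_add_right, frameTime]
    congr 2; ring
  have hsplit : (1 + osc ξ (1 / fs)) *
      ∑ i ∈ Finset.range (N + 1), (cardinal fs t (i + 1) : ℂ) * osc ξ (frameTime fs i) =
      ∑ i ∈ Finset.range (N + 1), (cardinal fs t (i + 1) : ℂ) * osc ξ (frameTime fs i) +
      ∑ i ∈ Finset.range (N + 1), (cardinal fs t (i + 1) : ℂ) * osc ξ ((i + 2) / fs) := by
    rw [add_mul, one_mul, Finset.mul_sum, Finset.sum_congr rfl fun i _ ↦ e i]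
  rw [Finset.sum_image hinj, samplingError, mul_sub, sub_sub, sub_sub, hsplit,
    Finset.sum_range_succ', Finset.sum_range_succ]
  congr 1
  have e3 : ∀ i : ℕ, ((cardinal fs t ((i : ℤ) + 2) + cardinal fs t ((i : ℤ) + 2 - 1) : ℝ) : ℂ) *
      osc ξ ((((i : ℤ) + 2 : ℤ) : ℝ) / fs) =
      (cardinal fs t (((i + 1 : ℕ) : ℤ) + 1) : ℂ) * osc ξ (frameTime fs (i + 1)) +
      (cardinal fs t ((i : ℤ) + 1) : ℂ) * osc ξ ((i + 2) / fs) := fun i ↦ by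
    have a1 : ((i : ℤ) + 2 - 1) = i + 1 := by ring
    have a2 : ((i + 1 : ℕ) : ℤ) + 1 = i + 2 := by push_cast; ring
    have a3 : frameTime fs (i + 1) = ((i : ℝ) + 2) / fs := by
      unfold frameTime; push_cast; ring
    rw [a1, a2, a3]; push_cast; ring
  rw [Finset.sum_congr rfl fun i _ ↦ e3 i, Finset.sum_add_distrib]
  simp only [frameTime, Nat.cast_zero, zero_add]
  ring

/-- Away from the Nyquist frequency the truncated cardinal series converges uniformly. -/
lemma exists_norm_samplingError_le {fs β η : ℝ} (hfs : 0 < fs) (hβ0 : 0 ≤ β) (hβ : 2 * β < fs)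
    (hη : 0 < η) :
    ∃ L : ℝ, 2 ≤ L ∧ ∀ (F : ℕ) (t : ℝ), L ≤ fs * t → fs * t ≤ F - L →
      ∀ ξ, |ξ| ≤ β → ‖samplingError fs F t ξ‖ ≤ η := by
  set κ := 1 + Real.cos (2 * Real.pi * β / fs) with hκ
  have hκ0 : 0 < κ := one_add_cos_pos hfs hβ0 hβ
  obtain ⟨L₁, hL₁, htail⟩ := exists_tail_bound (η := κ * η / 3) (by positivity)
  set M := max L₁ (3 / (κ * η)) with hM
  have hM1 : L₁ ≤ M := le_max_left _ _
  have hM2 : 1 / M ≤ κ * η / 3 := by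
    rw [one_div_le (by linarith) (by positivity), one_div_div]
    exact le_max_right _ _
  -- The two boundary terms and the regularised tail each receive `κ * η / 3`. The extra `1`
  -- accounts for the index `1`, which lies outside the overlap although it lies in the window.
  refine ⟨1 + M, by linarith, fun F t ht ht' ξ hξ ↦ ?_⟩
  obtain ⟨N, rfl⟩ : ∃ N, F = N + 1 := Nat.exists_eq_succ_of_ne_zero fun h ↦ by
    rw [h, Nat.cast_zero] at ht'; linarith
  have hnorm := one_add_cos_le_norm_one_add_osc hfs hβ hξ
  push_cast at ht'
  have b1 : ‖(cardinal fs t 1 : ℂ) * osc ξ (1 / fs)‖ ≤ κ * η / 3 := by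
    rw [norm_mul, norm_osc, mul_one, Complex.norm_real]
    refine (abs_cardinal_le (L := M) (by linarith) ?_).trans hM2
    exact le_trans (by push_cast; linarith) (le_abs_self _)
  have b2 : ‖(cardinal fs t (N + 1) : ℂ) * osc ξ ((N + 2) / fs)‖ ≤ κ * η / 3 := by
    rw [norm_mul, norm_osc, mul_one, Complex.norm_real]
    refine (abs_cardinal_le (L := M) (by linarith) ?_).trans hM2
    exact le_trans (by push_cast; linarith) (neg_le_abs _)
  have b3 := norm_sub_sum_le_of_hasSum (hasSum_regularized hfs t (ξ := ξ) (by linarith))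
    ((Finset.range N).image fun i : ℕ ↦ (i : ℤ) + 2) (η := κ * η / 3) fun s hs ↦ by
      have hfar : ∀ n ∈ s, L₁ ≤ |fs * t - n| := fun n hn ↦ by
        have hnW : n ≤ 1 ∨ (N : ℤ) + 2 ≤ n := by
          by_contra hc
          push Not at hc
          refine Finset.disjoint_left.1 hs hn (Finset.mem_image.2 ⟨(n - 2).toNat, ?_, ?_⟩)
          · rw [Finset.mem_range]; omega
          · omega
        rcases hnW with h | h
        · have : (n : ℝ) ≤ 1 := by exact_mod_cast h
          exact le_trans (by linarith) (le_abs_self _)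
        · have : (N : ℝ) + 2 ≤ n := by exact_mod_cast h
          exact le_trans (by linarith) (neg_le_abs _)
      refine (norm_sum_le _ _).trans (le_trans (Finset.sum_le_sum fun n hn ↦ ?_)
        (htail (fs * t) s hfar))
      rw [norm_mul, norm_osc, mul_one, Complex.norm_real]
      exact abs_cardinal_add_cardinal_le (hL₁.trans (hfar n hn))
  have hid := congrArg norm (one_add_osc_mul_samplingError (fs := fs) N t ξ)
  rw [norm_mul] at hid
  have hle := hid.le.trans ((norm_sub_le _ _).trans (add_le_add (norm_sub_le _ _) le_rfl))
  have h0 := norm_nonneg (samplingError fs (N + 1) t ξ)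
  have : κ * ‖samplingError fs (N + 1) t ξ‖ ≤ κ * η := by
    have := mul_le_mul_of_nonneg_right hnorm h0
    linarith
  exact le_of_mul_le_mul_left this hκ0

/-! ### Pairing kernels with a spectrum -/

lemma norm_integral_mul_le_sqrt {α : Type*} [MeasurableSpace α] {μ : Measure α} {f g : α → ℂ}
    (hf : MemLp f 2 μ) (hg : MemLp g 2 μ) :
    ‖∫ x, f x * g x ∂μ‖ ≤ √(∫ x, ‖f x‖ ^ 2 ∂μ) * √(∫ x, ‖g x‖ ^ 2 ∂μ) := by
  have h := integral_mul_le_Lp_mul_Lq_of_nonneg (μ := μ) (f := fun x ↦ ‖f x‖)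
    (g := fun x ↦ ‖g x‖) Real.HolderConjugate.two_two (.of_forall fun _ ↦ norm_nonneg _)
    (.of_forall fun _ ↦ norm_nonneg _) (by simpa using hf.norm) (by simpa using hg.norm)
  simp only [Real.rpow_two, ← Real.sqrt_eq_rpow] at h
  refine (norm_integral_le_integral_norm _).trans ?_
  simpa only [norm_mul] using h

/-- The integral of `w` against a spectrum, of which `Spectrum.signal` is the case
`w = osc · t`. -/
def Spectrum.pairing (S : Spectrum) (fμ : ℝ) (w : ℝ → ℂ) : ℂ :=
  (∫ f in Set.Icc (-fμ) fμ, S.density f * w f) + ∑ ν ∈ S.line.support, S.line ν * w ν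

variable {fμ νmax E A : ℝ} {d : ℝ → ℝ} {S : Spectrum}

lemma HasSpectrum.integrable_mul (hS : HasSpectrum fμ νmax E A d S) {w : ℝ → ℂ}
    (hw : Continuous w) :
    Integrable (fun f ↦ S.density f * w f) (volume.restrict (Set.Icc (-fμ) fμ)) :=
  hS.memLp.integrable_mul (memLp_Icc_of_continuous hw 2 _ _)

lemma HasSpectrum.pairing_sub (hS : HasSpectrum fμ νmax E A d S) {v w : ℝ → ℂ}
    (hv : Continuous v) (hw : Continuous w) :
    S.pairing fμ (fun ξ ↦ v ξ - w ξ) = S.pairing fμ v - S.pairing fμ w := by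
  simp only [Spectrum.pairing, mul_sub, Finset.sum_sub_distrib]
  rw [integral_sub (hS.integrable_mul hv) (hS.integrable_mul hw)]
  ring

lemma HasSpectrum.pairing_sum (hS : HasSpectrum fμ νmax E A d S) {ι : Type*} (s : Finset ι)
    (c : ι → ℂ) {w : ι → ℝ → ℂ} (hw : ∀ i, Continuous (w i)) :
    S.pairing fμ (fun ξ ↦ ∑ i ∈ s, c i * w i ξ) = ∑ i ∈ s, c i * S.pairing fμ (w i) := by
  have e : ∀ i f, S.density f * (c i * w i f) = c i * (S.density f * w i f) := fun i f ↦
    mul_left_comm _ _ _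
  have e' : ∀ i f, S.line f * (c i * w i f) = c i * (S.line f * w i f) := fun i f ↦
    mul_left_comm _ _ _
  simp only [Spectrum.pairing, mul_add, Finset.sum_add_distrib, Finset.mul_sum, e, e']
  rw [integral_finsetSum _ fun i _ ↦ (hS.integrable_mul (hw i)).const_mul _, Finset.sum_comm]
  simp only [integral_const_mul]

lemma HasSpectrum.eq_pairing (hS : HasSpectrum fμ νmax E A d S) (t : ℝ) :
    (d t : ℂ) = S.pairing fμ fun ξ ↦ osc ξ t :=
  hS.eq_signal t

lemma HasSpectrum.norm_integral_mul_le (hS : HasSpectrum fμ νmax E A d S) {w : ℝ → ℂ}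
    (hw : Continuous w) {Q : ℝ} (hQ : ∫ ξ in Set.Icc (-fμ) fμ, ‖w ξ‖ ^ 2 ≤ Q) :
    ‖∫ f in Set.Icc (-fμ) fμ, S.density f * w f‖ ≤ √E * √Q :=
  (norm_integral_mul_le_sqrt hS.memLp (memLp_Icc_of_continuous hw 2 _ _)).trans
    (mul_le_mul (Real.sqrt_le_sqrt hS.energy_le) (Real.sqrt_le_sqrt hQ) (Real.sqrt_nonneg _)
      (Real.sqrt_nonneg _))

lemma HasSpectrum.norm_sum_line_mul_le (hS : HasSpectrum fμ νmax E A d S) {w : ℝ → ℂ} {M : ℝ}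
    (hM0 : 0 ≤ M) (hM : ∀ ν ∈ S.line.support, ‖w ν‖ ≤ M) :
    ‖∑ ν ∈ S.line.support, S.line ν * w ν‖ ≤ A * M := by
  refine (norm_sum_le _ _).trans ?_
  calc ∑ ν ∈ S.line.support, ‖S.line ν * w ν‖ ≤ ∑ ν ∈ S.line.support, ‖S.line ν‖ * M :=
        Finset.sum_le_sum fun ν hν ↦ by
          rw [norm_mul]; exact mul_le_mul_of_nonneg_left (hM ν hν) (norm_nonneg _)
    _ ≤ A * M := by
        rw [← Finset.sum_mul]; exact mul_le_mul_of_nonneg_right hS.amplitude_le hM0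

lemma HasSpectrum.amplitude_nonneg (hS : HasSpectrum fμ νmax E A d S) : 0 ≤ A :=
  (Finset.sum_nonneg fun _ _ ↦ norm_nonneg _).trans hS.amplitude_le

lemma HasSpectrum.abs_le (hS : HasSpectrum fμ νmax E A d S) (hfμ : 0 ≤ fμ) (t : ℝ) :
    |d t| ≤ √E * √(2 * fμ) + A := by
  rw [← Real.norm_eq_abs, ← Complex.norm_real, hS.eq_pairing t]
  refine (norm_add_le _ _).trans (add_le_add (hS.norm_integral_mul_le (by fun_prop) ?_) ?_)
  · simp [hfμ]; linarith
  · simpa using hS.norm_sum_line_mul_le (w := fun ξ ↦ osc ξ t) zero_le_one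
      fun ν _ ↦ (norm_osc ν t).le

lemma setIntegral_band_le {fs : ℝ} (hfs : 2 * fμ ≤ fs) (hfμ : 0 ≤ fμ) {w : ℝ → ℂ}
    (hw : Continuous w) :
    ∫ ξ in Set.Icc (-fμ) fμ, ‖w ξ‖ ^ 2 ≤ ∫ ξ in -(fs / 2)..(fs / 2), ‖w ξ‖ ^ 2 := by
  rw [intervalIntegral.integral_of_le (by linarith), ← integral_Icc_eq_integral_Ioc]
  refine setIntegral_mono_set ?_ (.of_forall fun _ ↦ by positivity)
    (Set.Icc_subset_Icc (by linarith) (by linarith)).eventuallyLE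
  exact (Continuous.continuousOn (by fun_prop)).integrableOn_Icc

/-! ### Reconstruction of the signal between the frames -/

/-- The cardinal series that interpolates the samples `s` of the first `F` frames. -/
def interpolation (fs : ℝ) (F : ℕ) (s : ℕ → ℝ) (t : ℝ) : ℝ :=
  ∑ i ∈ Finset.range F, s i * cardinal fs t (i + 1)

lemma interpolation_frameTime {fs : ℝ} (hfs : 0 < fs) {F : ℕ} (s : ℕ → ℝ) {n : ℕ} (hn : n < F) :
    interpolation fs F s (frameTime fs n) = s n := by
  simp only [interpolation, cardinal_frameTime hfs]
  rw [Finset.sum_eq_single n]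
  · simp
  · intro i _ hi
    rw [if_neg (by omega), mul_zero]
  · intro h; exact absurd (Finset.mem_range.2 hn) h

lemma HasSpectrum.pairing_samplingError (hS : HasSpectrum fμ νmax E A d S) (fs : ℝ) (F : ℕ)
    (t : ℝ) : S.pairing fμ (samplingError fs F t) =
      d t - ∑ i ∈ Finset.range F, (cardinal fs t (i + 1) : ℂ) * d (frameTime fs i) := by
  unfold samplingError
  rw [hS.pairing_sub (by fun_prop) (by fun_prop), hS.pairing_sum _ _ (by fun_prop),
    ← hS.eq_pairing]
  simp_rw [← hS.eq_pairing]

/-- The density is controlled by the mean-square bound, the lines and the constant `d t₀` by the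
uniform bound. The constant acts as a line at `0`, hence `max νmax 0`. -/
lemma exists_abs_interpolation_sub_le (fμ fs νmax E A ε : ℝ) (hfμ : 0 < fμ) (hfs : 2 * fμ ≤ fs)
    (hνs : 2 * νmax < fs) (hε : 0 < ε) :
    ∃ L : ℝ, 2 ≤ L ∧ ∀ (F : ℕ) (t : ℝ), L ≤ fs * t → fs * t ≤ F - L →
      ∀ (d : ℝ → ℝ) (S : Spectrum), HasSpectrum fμ νmax E A d S → ∀ t₀ : ℝ,
        |interpolation fs F (fun n ↦ d (frameTime fs n) - d t₀) t - (d t - d t₀)| ≤ ε := by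
  have hfs0 : 0 < fs := by linarith
  set D := √E * √(2 * fμ) + |A| with hD
  have hD0 : 0 ≤ D := by positivity
  have hβ : 2 * max νmax 0 < fs := by
    rcases max_cases νmax 0 with h | h <;> linarith
  -- The accuracies are chosen so that the density contributes at most `ε / 2`, and the lines and
  -- the constant together at most `ε / 2`; the summands `+ 1` keep the denominators positive.
  obtain ⟨L₁, hL₁, h₁⟩ := exists_integral_sq_samplingError_le (η := (ε / (2 * (√E + 1))) ^ 2)
    hfs0 (by positivity)
  obtain ⟨L₂, hL₂, h₂⟩ := exists_norm_samplingError_le (η := ε / (2 * (|A| + D + 1))) hfs0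
    (le_max_right νmax 0) hβ (by positivity)
  refine ⟨max L₁ L₂, hL₁.trans (le_max_left _ _), fun F t ht ht' d S hS t₀ ↦ ?_⟩
  have hl := le_max_left L₁ L₂
  have hr := le_max_right L₁ L₂
  have q := h₁ F t (hl.trans ht) (by linarith)
  have p := h₂ F t (hr.trans ht) (by linarith)
  have key : ((interpolation fs F (fun n ↦ d (frameTime fs n) - d t₀) t - (d t - d t₀) : ℝ) : ℂ) =
      d t₀ * samplingError fs F t 0 - S.pairing fμ (samplingError fs F t) := by
    rw [hS.pairing_samplingError]
    simp only [interpolation, samplingError, osc_zero_left]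
    push_cast
    simp only [sub_mul, Finset.sum_sub_distrib, mul_sub, Finset.mul_sum, mul_one]
    simp only [mul_comm]
    abel
  rw [← Real.norm_eq_abs, ← Complex.norm_real, key]
  have hc := continuous_samplingError fs F t
  have b1 := hS.norm_integral_mul_le hc ((setIntegral_band_le hfs hfμ.le hc).trans q)
  rw [Real.sqrt_sq (by positivity)] at b1
  have b2 := hS.norm_sum_line_mul_le (w := samplingError fs F t) (by positivity) fun ν hν ↦
    p ν ((hS.abs_line_le ν hν).trans (le_max_left _ _))
  have b3 : ‖(d t₀ : ℂ) * samplingError fs F t 0‖ ≤ D * (ε / (2 * (|A| + D + 1))) := by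
    rw [norm_mul, Complex.norm_real]
    have := hS.abs_le hfμ.le t₀
    have := le_abs_self A
    exact mul_le_mul (by rw [Real.norm_eq_abs]; linarith) (p 0 (by simp)) (norm_nonneg _) hD0
  have b4 := mul_le_mul_of_nonneg_right (le_abs_self A)
    (show 0 ≤ ε / (2 * (|A| + D + 1)) by positivity)
  have b5 : √E * (ε / (2 * (√E + 1))) ≤ ε / 2 := by
    rw [mul_div_assoc', div_le_div_iff₀ (by positivity) two_pos]
    nlinarith [Real.sqrt_nonneg E]
  have b6 : (|A| + D) * (ε / (2 * (|A| + D + 1))) ≤ ε / 2 := by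
    rw [mul_div_assoc', div_le_div_iff₀ (by positivity) two_pos]
    nlinarith [abs_nonneg A]
  have hp := norm_add_le (∫ f in Set.Icc (-fμ) fμ, S.density f * samplingError fs F t f)
    (∑ ν ∈ S.line.support, S.line ν * samplingError fs F t ν)
  refine (norm_sub_le _ _).trans ?_
  rw [Spectrum.pairing]
  rw [add_mul] at b6
  linarith

/-! ### Recovery of the line amplitudes -/

/-- The mean over `F` frames of the discrete-time exponential of frequency `ξ`, demodulated at the
frequency `f`. -/
def dftMean (fs : ℝ) (F : ℕ) (f ξ : ℝ) : ℂ :=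
  ∑ i ∈ Finset.range F, (osc f (-frameTime fs i) / F) * osc ξ (frameTime fs i)

@[fun_prop] lemma continuous_dftMean (fs : ℝ) (F : ℕ) (f : ℝ) : Continuous (dftMean fs F f) := by
  unfold dftMean; fun_prop

lemma osc_neg_mul_osc (f ξ t : ℝ) : osc f (-t) * osc ξ t = osc (ξ - f) t := by
  rw [osc_neg_right, ← osc_add_left]; congr 1; ring

lemma dftMean_self (fs : ℝ) {F : ℕ} (hF : 0 < F) (f : ℝ) : dftMean fs F f f = 1 := by
  have : (F : ℂ) ≠ 0 := by exact_mod_cast hF.ne'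
  simp only [dftMean, div_mul_eq_mul_div, osc_neg_mul_osc, sub_self, osc_zero_left]
  simp [this]

/-- The norm is `2 |sin (π u / fs)|`, and Jordan's inequality applies to `|u| / fs` or, past `1 /
2`, to its reflection `1 - |u| / fs`. The upper bound on `|u|` excludes aliasing. -/
lemma four_mul_le_norm_osc_sub_one {fs u γ : ℝ} (hfs : 0 < fs) (hγ : 0 < γ) (h : γ * fs ≤ |u|)
    (h' : |u| ≤ (1 - γ) * fs) : 4 * γ ≤ ‖osc u (1 / fs) - 1‖ := by
  have hpi := Real.pi_pos
  rw [osc, mul_comm _ Complex.I, Complex.norm_exp_I_mul_ofReal_sub_one, norm_mul, Real.norm_ofNat]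
  set y := |u| / fs with hy
  have hy1 : γ ≤ y := (le_div_iff₀ hfs).2 h
  have hy2 : y ≤ 1 - γ := (div_le_iff₀ hfs).2 h'
  have hy0 : 0 ≤ y := by positivity
  have e : |2 * Real.pi * u * (1 / fs) / 2| = Real.pi * y := by
    rw [show 2 * Real.pi * u * (1 / fs) / 2 = Real.pi * (u / fs) by ring, abs_mul, abs_div,
      abs_of_pos hpi, abs_of_pos hfs]
  have e2 : ‖Real.sin (2 * Real.pi * u * (1 / fs) / 2)‖ = |Real.sin (Real.pi * y)| := by
    rw [← e, Real.norm_eq_abs]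
    rcases abs_choice (2 * Real.pi * u * (1 / fs) / 2) with h | h <;> rw [h]
    rw [Real.sin_neg, abs_neg]
  rw [e2]
  have hs : 2 * γ ≤ Real.sin (Real.pi * y) := by
    rcases le_total y (1 / 2) with hle | hle
    · have := Real.mul_le_sin (x := Real.pi * y) (by positivity) (by nlinarith)
      rw [← mul_assoc, div_mul_cancel₀ _ hpi.ne'] at this
      linarith
    · have := Real.mul_le_sin (x := Real.pi * (1 - y)) (by nlinarith) (by nlinarith)
      rw [← mul_assoc, div_mul_cancel₀ _ hpi.ne', mul_sub Real.pi, mul_one, Real.sin_pi_sub] at this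
      linarith
  linarith [le_abs_self (Real.sin (Real.pi * y))]

lemma norm_dftMean_le {fs f ξ γ : ℝ} (hfs : 0 < fs) (hγ : 0 < γ) (F : ℕ)
    (h : γ * fs ≤ |f - ξ|) (h' : |f - ξ| ≤ (1 - γ) * fs) :
    ‖dftMean fs F f ξ‖ ≤ 1 / (2 * γ) / F := by
  set u := ξ - f with hu
  rw [abs_sub_comm] at h h'
  set r := osc u (1 / fs) with hr
  have hn := four_mul_le_norm_osc_sub_one hfs hγ h h'
  have e : dftMean fs F f ξ = r * (∑ i ∈ Finset.range F, r ^ i) / F := by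
    simp only [dftMean, div_mul_eq_mul_div, osc_neg_mul_osc, ← Finset.sum_div, Finset.mul_sum]
    congr 1
    refine Finset.sum_congr rfl fun i _ ↦ ?_
    rw [hr, ← osc_mul_nat, ← osc_add_right, frameTime]
    congr 1; ring
  have hg : ‖∑ i ∈ Finset.range F, r ^ i‖ * ‖r - 1‖ ≤ 2 := by
    rw [← norm_mul, geom_sum_mul]
    refine (norm_sub_le _ _).trans ?_
    rw [norm_pow, hr, norm_osc, one_pow, norm_one]; norm_num
  rw [e, norm_div, norm_mul, hr, norm_osc, one_mul, Complex.norm_natCast, ← hr]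
  gcongr
  rw [le_div_iff₀ (by positivity)]
  have := norm_nonneg (∑ i ∈ Finset.range F, r ^ i)
  nlinarith

/-- Parseval: the kernel has at most `F` nonzero Fourier coefficients, each of modulus `1 / F`. -/
lemma integral_sq_dftMean_le {fs : ℝ} (hfs : 0 < fs) (F : ℕ) (f : ℝ) :
    ∫ ξ in -(fs / 2)..(fs / 2), ‖dftMean fs F f ξ‖ ^ 2 ≤ fs / F := by
  rcases Nat.eq_zero_or_pos F with rfl | hF
  · simp [dftMean]
  have hF' : (0 : ℝ) < F := by exact_mod_cast hF
  have hab : -(fs / 2) < fs / 2 := by linarith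
  have hs := hasSum_sq_fourierCoeffOn hab (f := dftMean fs F f)
    ((memLp_Icc_of_continuous (continuous_dftMean fs F f) _ _ _).mono_measure
      (Measure.restrict_mono Set.Ioc_subset_Icc_self le_rfl))
  have hcoef : ∀ n : ℤ, ‖fourierCoeffOn hab (dftMean fs F f) n‖ ^ 2 ≤
      if n ∈ Finset.Icc 1 (F : ℤ) then (1 / (F : ℝ)) ^ 2 else 0 := fun n ↦ by
    unfold dftMean
    rw [fourierCoeffOn_sum_osc hfs]
    split_ifs with hn
    · rw [Finset.mem_Icc] at hn
      rw [Finset.sum_eq_single (n - 1).toNat]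
      · have : (((n - 1).toNat : ℕ) : ℤ) + 1 = n := by omega
        rw [this, if_pos rfl]; simp
      · intro i _ hi
        rw [if_neg (by omega)]; simp
      · intro hi
        simp at hi; omega
    · rw [Finset.mem_Icc] at hn
      rw [Finset.sum_eq_zero]
      · simp
      · intro i hi
        have := Finset.mem_range.1 hi
        rw [if_neg (by omega)]; simp
  have := hasSum_le_of_sum_le hs (c := 1 / (F : ℝ)) fun s ↦ ?_
  · rw [show fs / 2 - -(fs / 2) = fs by ring, smul_eq_mul, inv_mul_le_iff₀ hfs] at this
    rwa [mul_one_div] at this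
  · refine (Finset.sum_le_sum fun n _ ↦ hcoef n).trans ?_
    rw [← Finset.sum_filter, Finset.sum_const, nsmul_eq_mul]
    have hcard : (s.filter (· ∈ Finset.Icc 1 (F : ℤ))).card ≤ F := by
      refine (Finset.card_le_card fun n hn ↦ (Finset.mem_filter.1 hn).2).trans ?_
      simp
    calc ((s.filter (· ∈ Finset.Icc 1 (F : ℤ))).card : ℝ) * (1 / (F : ℝ)) ^ 2 ≤
        F * (1 / (F : ℝ)) ^ 2 := by
          gcongr
      _ = 1 / (F : ℝ) := by field_simp

/-- The normalised discrete-time Fourier transform of the samples `s` at frequency `f`. -/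
def dft (fs : ℝ) (F : ℕ) (s : ℕ → ℝ) (f : ℝ) : ℂ :=
  ∑ i ∈ Finset.range F, (osc f (-frameTime fs i) / F) * s i

lemma HasSpectrum.dft_sub_line (hS : HasSpectrum fμ νmax E A d S) (fs : ℝ) (F : ℕ) (f t₀ : ℝ) :
    dft fs F (fun n ↦ d (frameTime fs n) - d t₀) f - S.line f =
      (∫ ξ in Set.Icc (-fμ) fμ, S.density ξ * dftMean fs F f ξ) +
      (∑ ν ∈ S.line.support, S.line ν * (dftMean fs F f ν - if ν = f then 1 else 0)) -
      d t₀ * dftMean fs F f 0 := by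
  have h := hS.pairing_sum (Finset.range F) (fun i ↦ osc f (-frameTime fs i) / F)
    (w := fun i ξ ↦ osc ξ (frameTime fs i)) (by fun_prop)
  simp_rw [← hS.eq_pairing] at h
  have hl : ∑ ν ∈ S.line.support, S.line ν * (if ν = f then 1 else 0) = S.line f := by
    simp +contextual [Finset.sum_ite_eq']
  have h0 : d t₀ * dftMean fs F f 0 =
      ∑ i ∈ Finset.range F, (osc f (-frameTime fs i) / F) * (d t₀ : ℂ) := by
    simp only [dftMean, osc_zero_left, mul_one, Finset.mul_sum]
    simp only [mul_comm]
  simp only [mul_sub, Finset.sum_sub_distrib, hl, h0, dft]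
  push_cast
  simp only [mul_sub, Finset.sum_sub_distrib]
  rw [← h]
  simp only [Spectrum.pairing, dftMean]
  ring

lemma HasSpectrum.norm_dft_sub_line_le (hS : HasSpectrum fμ νmax E A d S) {fs δ γ f : ℝ} {F : ℕ}
    (hfμ : 0 < fμ) (hfs : 2 * fμ ≤ fs) (hF : 0 < F) (hγ : 0 < γ)
    (hγδ : γ * fs ≤ δ) (hγν : γ * fs ≤ fs / 2 - max νmax 0)
    (hf : |f| ≤ fμ) (hδf : δ ≤ |f|) (hδ : ∀ ν ∈ S.line.support, ν ≠ f → δ ≤ |f - ν|) (t₀ : ℝ) :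
    ‖dft fs F (fun n ↦ d (frameTime fs n) - d t₀) f - S.line f‖ ≤
      √E * √(fs / F) + (√E * √(2 * fμ) + 2 * A) * (1 / (2 * γ) / F) := by
  have hfs0 : 0 < fs := by linarith
  have hc := continuous_dftMean fs F f
  -- No aliasing: `|f - ν| ≤ fs / 2 + max νmax 0 ≤ (1 - γ) * fs`, by the choice of `γ`.
  have hsep : ∀ ν, |ν| ≤ max νmax 0 → δ ≤ |f - ν| → ‖dftMean fs F f ν‖ ≤ 1 / (2 * γ) / F :=
    fun ν hν hd ↦ norm_dftMean_le hfs0 hγ F (hγδ.trans hd) (by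
      have := abs_sub f ν
      linarith)
  rw [hS.dft_sub_line]
  have b1 := hS.norm_integral_mul_le hc
    ((setIntegral_band_le hfs hfμ.le hc).trans (integral_sq_dftMean_le hfs0 F f))
  have b2 := hS.norm_sum_line_mul_le (w := fun ν ↦ dftMean fs F f ν - if ν = f then 1 else 0)
    (M := 1 / (2 * γ) / F) (by positivity) fun ν hν ↦ by
      by_cases h : ν = f
      · simp only [h, dftMean_self fs hF, if_true, sub_self, norm_zero]; positivity
      · simp only [h, if_false, sub_zero]
        exact hsep ν ((hS.abs_line_le ν hν).trans (le_max_left _ _)) (hδ ν hν h)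
  have b3 : ‖(d t₀ : ℂ) * dftMean fs F f 0‖ ≤ (√E * √(2 * fμ) + A) * (1 / (2 * γ) / F) := by
    rw [norm_mul, Complex.norm_real, Real.norm_eq_abs]
    have hA := hS.amplitude_nonneg
    exact mul_le_mul (hS.abs_le hfμ.le t₀) (hsep 0 (by simp) (by simpa using hδf))
      (norm_nonneg _) (by positivity)
  refine (norm_sub_le _ _).trans ((add_le_add ((norm_add_le _ _).trans (add_le_add b1 b2))
    b3).trans (le_of_eq ?_))
  ring

lemma exists_norm_dft_sub_line_le (fμ fs νmax E A ε δ : ℝ) (hfμ : 0 < fμ) (hfs : 2 * fμ ≤ fs)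
    (hνs : 2 * νmax < fs) (hε : 0 < ε) (hδ : 0 < δ) :
    ∃ N : ℝ, 0 < N ∧ ∀ F : ℕ, N ≤ F → ∀ (d : ℝ → ℝ) (S : Spectrum),
      HasSpectrum fμ νmax E A d S → ∀ t₀ f : ℝ, |f| ≤ fμ → δ ≤ |f| →
        (∀ ν ∈ S.line.support, ν ≠ f → δ ≤ |f - ν|) →
        ‖dft fs F (fun n ↦ d (frameTime fs n) - d t₀) f - S.line f‖ ≤ ε := by
  have hfs0 : 0 < fs := by linarith
  have hβ : 0 < fs / 2 - max νmax 0 := by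
    rcases max_cases νmax 0 with h | h <;> linarith
  set γ := min δ (fs / 2 - max νmax 0) / fs with hγ
  have hγ0 : 0 < γ := by positivity
  have hγfs : γ * fs = min δ (fs / 2 - max νmax 0) := div_mul_cancel₀ _ hfs0.ne'
  have hlim : Filter.Tendsto (fun F : ℕ ↦ √E * √(fs / F) +
      (√E * √(2 * fμ) + 2 * A) * (1 / (2 * γ) / F)) Filter.atTop (nhds 0) := by
    have h1 : Filter.Tendsto (fun F : ℕ ↦ √(fs / (F : ℝ))) Filter.atTop (nhds 0) := by
      simpa using (tendsto_const_div_atTop_nhds_zero_nat fs).sqrt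
    simpa using (h1.const_mul √E).add
      ((tendsto_const_div_atTop_nhds_zero_nat (1 / (2 * γ))).const_mul _)
  obtain ⟨N, hN⟩ := Filter.eventually_atTop.1 (hlim.eventually (ge_mem_nhds hε))
  -- The shift by `1` ensures `0 < F`, needed for the kernel to equal `1` at `f`.
  refine ⟨N + 1, by positivity, fun F hF d S hS t₀ f hf hδf hsep ↦ ?_⟩
  have hNF : N + 1 ≤ F := by exact_mod_cast hF
  exact (hS.norm_dft_sub_line_le hfμ hfs (by omega) hγ0 (hγfs.le.trans (min_le_left _ _))
    (hγfs.le.trans (min_le_right _ _)) hf hδf hsep t₀).trans (hN F (by omega))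

/-! ### Phase unwrapping -/

/-- Displacements relative to the first frame, by unwrapping the phases of the samples `w`. -/
def unwrap (lam : ℝ) (w : ℕ → ℂ) (n : ℕ) : ℝ :=
  lam / (4 * Real.pi) * ∑ i ∈ Finset.range n, (w (i + 1) / w i).arg

/-- The samples of a range bin, continued by zero. -/
def samples {R F : ℕ} (z : Stream R F) (k : Fin R) (n : ℕ) : ℂ :=
  if h : n < F then z k ⟨n, h⟩ else 0

/-- Positive magnitudes do not affect the argument, and a phase difference in `(-π, π)` is its own
principal value. Thus the unknown magnitudes and, in differences, the static phase drop out. -/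
lemma arg_div_of_phase {a b φ ψ : ℝ} (ha : 0 < a) (hb : 0 < b) (h : |φ - ψ| < Real.pi) :
    ((a * Complex.exp (φ * Complex.I)) / (b * Complex.exp (ψ * Complex.I)) : ℂ).arg = φ - ψ := by
  have hb' : (b : ℂ) ≠ 0 := by exact_mod_cast hb.ne'
  have e : (a * Complex.exp (φ * Complex.I)) / (b * Complex.exp (ψ * Complex.I)) =
      ((a / b : ℝ) : ℂ) *
        (Complex.cos ((φ - ψ : ℝ) : ℂ) + Complex.sin ((φ - ψ : ℝ) : ℂ) * Complex.I) := by
    rw [← Complex.exp_mul_I, mul_div_mul_comm, ← Complex.exp_sub]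
    push_cast; congr 2; ring
  rw [e]
  exact Complex.arg_mul_cos_add_sin_mul_I (div_pos ha hb) ⟨(abs_lt.1 h).1, (abs_lt.1 h).2.le⟩

lemma unwrap_samples {R F : ℕ} {lam fs : ℝ} (hlam : 0 < lam) {z : Stream R F} {k : Fin R}
    {d : ℝ → ℝ} (hz : TargetAt lam fs z k d) (hd : SmallSteps F lam fs d) {n : ℕ} (hn : n < F) :
    unwrap lam (samples z k) n = d (frameTime fs n) - d (frameTime fs 0) := by
  obtain ⟨φ₀, a, ha, hza⟩ := hz
  have hpi := Real.pi_pos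
  have hstep : ∀ i ∈ Finset.range n, (samples z k (i + 1) / samples z k i).arg =
      4 * Real.pi / lam * (d (frameTime fs (i + 1)) - d (frameTime fs i)) := fun i hi ↦ by
    have hi' := Finset.mem_range.1 hi
    have e : φ₀ + 4 * Real.pi * d (frameTime fs (i + 1)) / lam -
        (φ₀ + 4 * Real.pi * d (frameTime fs i) / lam) =
        4 * Real.pi / lam * (d (frameTime fs (i + 1)) - d (frameTime fs i)) := by ring
    rw [samples, samples, dif_pos (by omega), dif_pos (by omega), hza, hza,
      arg_div_of_phase (ha _) (ha _), e]
    rw [e, abs_mul, abs_of_pos (by positivity)]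
    calc _ < 4 * Real.pi / lam * (lam / 4) :=
          mul_lt_mul_of_pos_left (hd i (by omega)) (by positivity)
      _ = Real.pi := by field_simp
  rw [unwrap, Finset.sum_congr rfl hstep, ← Finset.mul_sum,
    Finset.sum_range_sub fun i ↦ d (frameTime fs i)]
  field_simp

lemma interpolation_congr {fs : ℝ} {F : ℕ} {s s' : ℕ → ℝ} (h : ∀ n < F, s n = s' n) :
    interpolation fs F s = interpolation fs F s' :=
  funext fun _ ↦ Finset.sum_congr rfl fun i hi ↦ by rw [h i (Finset.mem_range.1 hi)]

lemma dft_congr {fs : ℝ} {F : ℕ} {s s' : ℕ → ℝ} (h : ∀ n < F, s n = s' n) :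
    dft fs F s = dft fs F s' :=
  funext fun _ ↦ Finset.sum_congr rfl fun i hi ↦ by rw [h i (Finset.mem_range.1 hi)]

/-! ### Leakage from the view -/

/-- With plaintext access, whatever leaks from the stream itself leaks from the view. -/
lemma Protocol.GrantsPlaintextAccess.leaksMicroDisplacement {R F : ℕ} {Coins View Out : Type*}
    {P : Protocol R F Coins View Out} (hP : P.GrantsPlaintextAccess)
    {lam fs fμ νmax E A ε δ m : ℝ}
    (h : (energyDetection R F).LeaksMicroDisplacement lam fs fμ νmax E A ε δ m) :
    P.LeaksMicroDisplacement lam fs fμ νmax E A ε δ m := by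
  obtain ⟨read, hread⟩ := hP
  obtain ⟨recon, spec, h⟩ := h
  refine ⟨fun v ↦ recon (read v), fun v ↦ spec (read v), fun z ω k d hz hd ↦ ?_⟩
  simp only [hread]
  exact h z () k d hz hd

lemma exists_duration_energyDetection_leaks (fμ fs νmax E A ε δ : ℝ) (hfμ : 0 < fμ)
    (hfs : 2 * fμ ≤ fs) (hνs : 2 * νmax < fs) (hε : 0 < ε) (hδ : 0 < δ) :
    ∃ Tmin : ℝ, 0 < Tmin ∧ ∀ (R F : ℕ) (lam : ℝ), 0 < lam → Tmin ≤ (F : ℝ) / fs →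
      (energyDetection R F).LeaksMicroDisplacement lam fs fμ νmax E A ε δ (Tmin / 4) := by
  have hfs0 : 0 < fs := by linarith
  obtain ⟨L, hL, hrec⟩ := exists_abs_interpolation_sub_le fμ fs νmax E A ε hfμ hfs hνs hε
  obtain ⟨N, hN, hspec⟩ := exists_norm_dft_sub_line_le fμ fs νmax E A ε δ hfμ hfs hνs hε hδ
  -- With this duration, the margin of a quarter of it spans at least `L` sampling steps at each
  -- end, and there are at least `N` frames.
  refine ⟨max (4 * L) N / fs, by positivity, fun R F lam hlam hT ↦
    ⟨fun z k ↦ interpolation fs F (unwrap lam (samples z k)),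
      fun z k ↦ dft fs F (unwrap lam (samples z k)), fun z ω k d hz hd ↦ ?_⟩⟩
  have hT' : max (4 * L) N ≤ F := by rwa [div_le_div_iff_of_pos_right hfs0] at hT
  have hm : L ≤ fs * (max (4 * L) N / fs / 4) := by
    have : fs * (max (4 * L) N / fs / 4) = max (4 * L) N / 4 := by field_simp
    rw [this]; linarith [le_max_left (4 * L) N]
  have hs : ∀ n < F, unwrap lam (samples z k) n = d (frameTime fs n) - d (frameTime fs 0) :=
    fun n hn ↦ unwrap_samples hlam hz hd hn
  simp only [energyDetection]
  rw [interpolation_congr hs, dft_congr hs]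
  refine ⟨fun n hn ↦ interpolation_frameTime hfs0 _ hn, fun S hS ↦ ⟨fun t ht ↦ ?_, fun f ↦ ?_⟩⟩
  · refine hrec F t ?_ ?_ d S hS _
    · exact hm.trans (mul_le_mul_of_nonneg_left ht.1 hfs0.le)
    · have := mul_le_mul_of_nonneg_left ht.2 hfs0.le
      rw [mul_sub, mul_div_cancel₀ _ hfs0.ne'] at this
      linarith
  · exact hspec F ((le_max_right _ _).trans hT') d S hS _ f

end Radar

end

/-- `Tmin` depends only on the sampling rate, the band and the class of signals, the accuracy `ε` and
the frequency resolution `δ`; not on the wavelength, the protocol, or the observed scene. -/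
theorem proposition1 (fμ fs νmax E A ε δ : ℝ) (hfμ : 0 < fμ) (hfs : 2 * fμ ≤ fs)
    (hνμ : νmax ≤ fμ) (hνs : 2 * νmax < fs) (hε : 0 < ε) (hδ : 0 < δ) :
    ∃ Tmin : ℝ, 0 < Tmin ∧
      ∀ (R F : ℕ) (lam : ℝ), 0 < lam → Tmin ≤ (F : ℝ) / fs →
        (∀ {Coins View Out : Type*} (P : Radar.Protocol R F Coins View Out),
          P.GrantsPlaintextAccess →
            P.LeaksMicroDisplacement lam fs fμ νmax E A ε δ (Tmin / 4)) ∧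
        (Radar.energyDetection R F).GrantsPlaintextAccess ∧
        (Radar.energyDetection R F).LeaksMicroDisplacement lam fs fμ νmax E A ε δ (Tmin / 4) := by
  obtain ⟨Tmin, hT, h⟩ :=
    Radar.exists_duration_energyDetection_leaks fμ fs νmax E A ε δ hfμ hfs hνs hε hδ
  exact ⟨Tmin, hT, fun R F lam hlam hF ↦ ⟨fun _ hP ↦ hP.leaksMicroDisplacement (h R F lam hlam hF),
    ⟨id, fun _ _ ↦ rfl⟩, h R F lam hlam hF⟩⟩
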